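/- Let $G$ be a finite simple planar graph (not necessarily connected) that contains no cycle of length $4$ as a subgraph. Let $\Delta(G)$ be its maximum degree, and let $G^2$ be the graph on $V(G)$ obtained from $G$ by adding an edge between every two vertices at distance exactly two in $G$. Then there is a linear order $\sigma$ of $V(G)$ such that each vertex $v$ is preceded in $\sigma$ by at most $\Delta(G)+72$ of its neighbours in $G^2$. Equivalently, $G^2$ is $(\Delta(G)+72)$-degenerate: every nonempty subgraph of $G^2$ has a vertex whose degree in that subgraph is at most $\Delta(G)+72$. -/

import Mathlib

namespace SimpleGraph

/-- The square of `G`: the graph on the same vertices obtained from `G` by adding an edge between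
every two vertices at distance two in `G`. (`G.dist` is `0` for vertices in different components,
so these never become adjacent.) -/
def square {V : Type*} (G : SimpleGraph V) : SimpleGraph V where
  Adj v w := G.Adj v w ∨ G.dist v w = 2
  symm := ⟨fun v w h => h.imp (fun h' => h'.symm) (fun h' => by rw [dist_comm]; exact h')⟩
  loopless := ⟨fun v h => by rcases h with h | h <;> simp at h⟩

/-- `G` is `k`-degenerate: every nonempty subgraph has a vertex of degree at most `k`
(for graphs on finitely many vertices). -/
def IsDegenerate {V : Type*} [Finite V] (G : SimpleGraph V) (k : ℕ) : Prop :=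
  ∀ H : G.Subgraph, H.verts.Nonempty → ∃ v ∈ H.verts, (H.neighborSet v).ncard ≤ k

/-- `G` contains no cycle of length `n` (as a subgraph, not necessarily induced). -/
def HasNoCycleOfLength {V : Type*} (G : SimpleGraph V) (n : ℕ) : Prop :=
  ∀ (v : V) (c : G.Walk v v), c.IsCycle → c.length ≠ n

/-- A rotation system (combinatorial embedding) of `G`: a permutation of the darts (oriented edges)
that cyclically permutes, for each vertex `v`, all the darts that start at `v`. It records the
cyclic order of the edges around each vertex in an embedding in an oriented surface. -/
structure RotationSystem {V : Type*} (G : SimpleGraph V) where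
  /-- The next dart in the cyclic order around the initial vertex. -/
  next : Equiv.Perm G.Dart
  fst_next : ∀ d : G.Dart, (next d).fst = d.fst
  sameCycle_next : ∀ d e : G.Dart, d.fst = e.fst → next.SameCycle d e

/-- The face permutation of a rotation system: go along the dart to its end, and continue with the
next dart around that vertex. Its cycles are the facial boundary walks. -/
def RotationSystem.facePerm {V : Type*} {G : SimpleGraph V} (R : G.RotationSystem) :
    Equiv.Perm G.Dart :=
  (Dart.symm_involutive (G := G)).toPerm.trans R.next

/-- The faces of the embedding, each component of `G` being embedded in a surface of its own:
the cycles of the face permutation, and one face around every isolated vertex. -/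
def RotationSystem.Face {V : Type*} {G : SimpleGraph V} (R : G.RotationSystem) : Type _ :=
  Quotient (Equiv.Perm.SameCycle.setoid R.facePerm) ⊕ {v : V // ∀ w, ¬ G.Adj v w}

/-- A finite graph is planar if it has a rotation system of genus zero. The embedding of a
component with `n` vertices, `m` edges and `f` faces is in a surface of genus `g ≥ 0`, where
`n - m + f = 2 - 2 * g`; so all the components are embedded in spheres exactly if
the numbers of all vertices, edges, faces and components satisfy the equation below. -/
def IsPlanar {V : Type*} [Finite V] (G : SimpleGraph V) : Prop :=
  ∃ R : G.RotationSystem,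
    Nat.card V + Nat.card R.Face = Nat.card G.edgeSet + 2 * Nat.card G.ConnectedComponent

end SimpleGraph

/-!
It suffices to find, for every nonempty set `S` of vertices, some `v ∈ S` that has at most
`Δ + 72` neighbours in `S` in the square (`IsPlanar.exists_card_square_neighbors_le`).

Suppose that there is none. Pass to a minimal subgraph `H` with the same adjacencies inside `S` in
the square (`exists_reduced_subgraph`): every vertex outside `S` that is not isolated now has all
its neighbours in `S`, at least two of them, and if exactly two, then these are not adjacent. Call
a vertex big if it has at least `19` neighbours in `S`. A vertex `v` of `S` has at most as many
neighbours in `S` in the square as its neighbours in `H` have neighbours in `S` altogether; so if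
`v` had degree at most five and at most one big neighbour, there would be at most `Δ + 4 * 18`.
Hence each vertex of `S` has degree at least six or has two big neighbours.

Let `B` be the set of big vertices and `A` the set of the other vertices of `S` with two big
neighbours. The edges between `A` and `B` form a planar graph of girth at least six, so
`|A| ≤ 3 |B|` (`IsPlanar.card_le_three_mul_card`). On the other hand, discharging gives
`∑ (6 - deg v) + ∑ (6 - 2 deg v) > 0`, where the first sum is over `S` and the second over the
vertices of degree at least three outside `S` (`IsPlanar.sum_charge_pos`). A vertex of `A`
contributes at most `4`, a vertex of `B` at most `-13`, and no other vertex a positive amount, so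
`0 < 4 |A| - 13 |B| ≤ - |B|`, a contradiction.

Both estimates apply Euler's formula to subgraphs of a planar graph
(`IsPlanar.exists_rotationSystem`). A rotation system with face permutation `ν * ι`, where `ν` is
the vertex permutation and `ι` reverses darts, is restricted to a subgraph by making the darts of
the deleted edges fixed points of `ν`, one after the other. Each step multiplies both `ν` and
`ν * ι` by the same transposition, and the number of vertices plus the number of faces minus twice
the number of components does not decrease (`Equiv.Perm.mapChar_le_mapChar_swap_mul`). In the end
each deleted edge is a component of its own, with two vertices and one face.
-/

/-! ### Counting the classes of an equivalence relation -/

namespace Setoid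

variable {α : Type*}

theorem card_quotient_le_of_le [Finite α] {r s : Setoid α} (h : r ≤ s) :
    Nat.card (Quotient s) ≤ Nat.card (Quotient r) := by
  refine Nat.card_le_card_of_surjective (Quotient.map id fun x y hxy => h hxy) ?_
  rintro ⟨x⟩
  exact ⟨Quotient.mk _ x, rfl⟩

theorem card_quotient_lt_of_le [Finite α] {r s : Setoid α} (h : r ≤ s) {a b : α}
    (hs : s a b) (hr : ¬ r a b) : Nat.card (Quotient s) < Nat.card (Quotient r) := by
  refine lt_of_le_of_ne (card_quotient_le_of_le h) fun heq => hr ?_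
  have hsurj : Function.Surjective
      (Quotient.map id fun x y hxy => h hxy : Quotient r → Quotient s) := by
    rintro ⟨x⟩
    exact ⟨Quotient.mk _ x, rfl⟩
  have hinj := ((Nat.bijective_iff_surjective_and_card _).2 ⟨hsurj, heq.symm⟩).injective
  exact Quotient.exact (hinj (a₁ := Quotient.mk r a) (a₂ := Quotient.mk r b) (Quotient.sound hs))

/-- Merging the classes of `a` and `b` loses at most one class. -/
theorem card_quotient_le_card_quotient_add_one [Finite α] (r s : Setoid α) (a b : α)
    (h : ∀ x y, s x y → r x y ∨ ((r x a ∨ r x b) ∧ (r y a ∨ r y b))) :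
    Nat.card (Quotient r) ≤ Nat.card (Quotient s) + 1 := by
  classical
  rw [← Finite.card_option]
  refine Nat.card_le_card_of_injective
    (fun q : Quotient r => if q = Quotient.mk r a then none else some (Quotient.mk s q.out)) ?_
  intro p q hpq
  have hout : ∀ q : Quotient r, q ≠ Quotient.mk r a → ¬ r q.out a := fun q hq hqa =>
    hq (by rw [← q.out_eq]; exact Quotient.sound hqa)
  by_cases hp : p = Quotient.mk r a <;> by_cases hq : q = Quotient.mk r a
  · rw [hp, hq]
  · simp [hp, hq] at hpq
  · simp [hp, hq] at hpq
  · simp only [hp, hq, if_false, Option.some.injEq] at hpq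
    have hr : r p.out q.out := by
      rcases h _ _ (Quotient.exact hpq) with h | ⟨h1, h2⟩
      · exact h
      · exact r.trans' (h1.resolve_left (hout p hp)) (r.symm' (h2.resolve_left (hout q hq)))
    rw [← p.out_eq, ← q.out_eq]
    exact Quotient.sound hr

/-- The equivalence relation obtained from `r` by merging the classes of `a` and `b`. -/
def merge (r : Setoid α) (a b : α) : Setoid α where
  r x y := r x y ∨ ((r x a ∨ r x b) ∧ (r y a ∨ r y b))
  iseqv := by
    refine ⟨fun x => Or.inl (r.refl' x), fun h => h.imp r.symm' And.symm, fun h h' => ?_⟩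
    have := @r.trans'
    have := @r.symm'
    grind

/-- Each element counts as its share of its class. -/
theorem card_quotient_eq_sum [Fintype α] (s : Setoid α) :
    (Nat.card (Quotient s) : ℚ) = ∑ x, 1 / (Nat.card {y // s x y} : ℚ) := by
  classical
  have : Fintype (Quotient s) := Fintype.ofFinite _
  rw [← Finset.sum_fiberwise (g := Quotient.mk s)]
  have key : ∀ q : Quotient s, ∑ x with Quotient.mk s x = q, 1 / (Nat.card {y // s x y} : ℚ) = 1 := by
    intro q
    induction q using Quotient.inductionOn with
    | h a =>
      have hc : ∀ x ∈ Finset.univ.filter fun x => Quotient.mk s x = Quotient.mk s a,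
          1 / (Nat.card {y // s x y} : ℚ) =
            1 / ((Finset.univ.filter fun x => Quotient.mk s x = Quotient.mk s a).card : ℚ) := by
        intro x hx
        have hxa : s x a := Quotient.exact (Finset.mem_filter.1 hx).2
        rw [Nat.card_eq_fintype_card, Fintype.card_subtype]
        congr 3
        ext y
        simp only [Finset.mem_filter, Finset.mem_univ, true_and]
        exact ⟨fun h => Quotient.sound (s.trans' (s.symm' h) hxa),
          fun h => s.trans' hxa (s.symm' (Quotient.exact h))⟩
      rw [Finset.sum_congr rfl hc, Finset.sum_const, nsmul_eq_mul, mul_one_div_cancel]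
      exact_mod_cast (Finset.card_pos.2 ⟨a, by simp⟩).ne'
  rw [Finset.sum_congr rfl fun q _ => key q]
  simp [Nat.card_eq_fintype_card]

end Setoid

/-! ### Multiplying a permutation by a transposition -/

namespace Equiv.Perm

variable {α : Type*}

/-- The number of cycles of a permutation, fixed points included. -/
noncomputable def numCycles (σ : Perm α) : ℕ :=
  Nat.card (Quotient (SameCycle.setoid σ))

theorem sameCycle_le_of_apply {σ : Perm α} {r : Setoid α} (h : ∀ x, r x (σ x)) :
    SameCycle.setoid σ ≤ r := by
  have hz : ∀ (n : ℕ) (x : α), r x ((σ ^ n) x) := by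
    intro n
    induction n with
    | zero => exact fun x => r.refl' x
    | succ n ih =>
      intro x
      rw [pow_succ', mul_apply]
      exact r.trans' (ih x) (h _)
  rintro x y ⟨i, rfl⟩
  obtain ⟨n, rfl | rfl⟩ := i.eq_nat_or_neg
  · exact hz n x
  · have := hz n ((σ ^ (-(n : ℤ))) x)
    rw [← zpow_natCast, ← mul_apply, ← zpow_add, add_neg_cancel, zpow_zero, one_apply] at this
    exact r.symm' this

variable [DecidableEq α]

/-- Multiplying by a transposition of two elements of one cycle separates them: the new cycle of
`a` is the arc of the old cycle from `a` to just before `b`. -/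
theorem not_sameCycle_swap_mul [Finite α] {σ : Perm α} {a b : α} (hab : a ≠ b)
    (h : σ.SameCycle a b) : ¬ (swap a b * σ).SameCycle a b := by
  classical
  have hex : ∃ k, (σ ^ k) a = b := h.exists_nat_pow_eq
  set k := Nat.find hex with hk
  have hkb : (σ ^ k) a = b := Nat.find_spec hex
  have hmin : ∀ i < k, (σ ^ i) a ≠ b := fun i hi => Nat.find_min hex hi
  have key : ∀ n, ∃ i < k, ((swap a b * σ) ^ n) a = (σ ^ i) a := by
    intro n
    induction n with
    | zero =>
      refine ⟨0, Nat.pos_of_ne_zero fun h0 => hab ?_, rfl⟩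
      rw [h0] at hkb
      exact hkb
    | succ n ih =>
      obtain ⟨i, hi, hn⟩ := ih
      rw [pow_succ', mul_apply, hn, mul_apply, ← mul_apply σ, ← pow_succ']
      by_cases hik : i + 1 = k
      · refine ⟨0, by omega, ?_⟩
        rw [hik, hkb, swap_apply_right]
        rfl
      · by_cases ha : (σ ^ (i + 1)) a = a
        · -- returning to `a` before `b` would keep the cycle of `a` from ever reaching `b`
          exfalso
          have : (σ ^ (k - (i + 1))) a = b := by
            rw [← hkb]
            conv_rhs => rw [show k = k - (i + 1) + (i + 1) by omega, pow_add, mul_apply, ha]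
          exact hmin _ (by omega) this
        · exact ⟨i + 1, by omega, swap_apply_of_ne_of_ne ha (hmin _ (by omega))⟩
  intro hs
  obtain ⟨n, hn⟩ := hs.exists_nat_pow_eq
  obtain ⟨i, hi, h'⟩ := key n
  exact hmin i hi (h'.symm.trans hn)

/-- Multiplying by a transposition of elements of two cycles joins these cycles. -/
theorem sameCycle_swap_mul [Finite α] {σ : Perm α} {a b : α}
    (h : ¬ σ.SameCycle a b) : (swap a b * σ).SameCycle a b := by
  have hpos : 0 < Function.minimalPeriod σ a :=
    Function.minimalPeriod_pos_of_mem_periodicPts (by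
      obtain ⟨n, hn, h⟩ := isOfFinOrder_iff_pow_eq_one.1 (isOfFinOrder_of_finite σ)
      exact ⟨n, hn, by simp [Function.IsPeriodicPt, Function.IsFixedPt, ← Perm.coe_pow, h]⟩)
  set m := Function.minimalPeriod σ a with hm
  have hma : (σ ^ m) a = a := by
    rw [Perm.coe_pow]
    exact Function.isPeriodicPt_minimalPeriod σ a
  have key : ∀ i < m, ((swap a b * σ) ^ i) a = (σ ^ i) a := by
    intro i
    induction i with
    | zero => exact fun _ => rfl
    | succ i ih =>
      intro hi
      rw [pow_succ', mul_apply, ih (by omega), mul_apply, ← mul_apply σ, ← pow_succ']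
      refine swap_apply_of_ne_of_ne (fun ha => ?_) (fun hb => h ⟨(i + 1 : ℕ), by exact_mod_cast hb⟩)
      rw [Perm.coe_pow] at ha
      exact Function.not_isPeriodicPt_of_pos_of_lt_minimalPeriod (by omega) hi ha
  refine ⟨m, ?_⟩
  rw [zpow_natCast, show m = m - 1 + 1 by omega, pow_succ', mul_apply, key _ (by omega), mul_apply,
    ← mul_apply σ, ← pow_succ', show m - 1 + 1 = m by omega, hma, swap_apply_left]

theorem swap_mul_apply_cases (σ : Perm α) (a b x : α) :
    (swap a b * σ) x = σ x ∨ σ x = a ∧ (swap a b * σ) x = b ∨ σ x = b ∧ (swap a b * σ) x = a := by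
  rw [mul_apply]
  by_cases h1 : σ x = a
  · exact Or.inr (Or.inl ⟨h1, by rw [h1, swap_apply_left]⟩)
  by_cases h2 : σ x = b
  · exact Or.inr (Or.inr ⟨h2, by rw [h2, swap_apply_right]⟩)
  exact Or.inl (swap_apply_of_ne_of_ne h1 h2)

theorem rel_swap_mul_apply {σ : Perm α} {a b : α} {r : Setoid α} (h : ∀ x, r x (σ x))
    (hab : r a b) (x : α) : r x ((swap a b * σ) x) := by
  rcases swap_mul_apply_cases σ a b x with h' | ⟨h1, h2⟩ | ⟨h1, h2⟩
  · rw [h']; exact h x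
  · rw [h2]; exact r.trans' (h1 ▸ h x) hab
  · rw [h2]; exact r.trans' (h1 ▸ h x) (r.symm' hab)

theorem numCycles_lt_numCycles_swap_mul [Finite α] {σ : Perm α} {a b : α} (hab : a ≠ b)
    (h : σ.SameCycle a b) : σ.numCycles < (swap a b * σ).numCycles :=
  Setoid.card_quotient_lt_of_le
    (sameCycle_le_of_apply (rel_swap_mul_apply (r := SameCycle.setoid σ)
      (fun _ => SameCycle.rfl.apply_right) h)) h (not_sameCycle_swap_mul hab h)

theorem numCycles_le_numCycles_swap_mul_add_one [Finite α] (σ : Perm α) (a b : α) :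
    σ.numCycles ≤ (swap a b * σ).numCycles + 1 := by
  refine Setoid.card_quotient_le_card_quotient_add_one _ _ a b fun x y h => ?_
  refine sameCycle_le_of_apply (r := (SameCycle.setoid σ).merge a b) (rel_swap_mul_apply ?_ ?_) h
  · exact fun x => Or.inl SameCycle.rfl.apply_right
  · exact Or.inr ⟨Or.inl SameCycle.rfl, Or.inr SameCycle.rfl⟩

end Equiv.Perm

/-! ### Detaching edges of a combinatorial map -/

namespace Equiv.Perm

variable {α : Type*}

/-- For a combinatorial map with vertex permutation `ν` and edge involution `ι`, the number of
vertices plus the number of faces minus twice the number of components. It is at most the number of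
edges, with equality exactly if all components are spheres. -/
noncomputable def mapChar (ν ι : Perm α) : ℤ :=
  ν.numCycles + (ν * ι).numCycles -
    2 * Nat.card (Quotient (SameCycle.setoid ν ⊔ SameCycle.setoid ι))

theorem card_subtype_sameCycle [Finite α] (σ : Perm α) (x : α) :
    Nat.card {y // SameCycle.setoid σ x y} = Function.minimalPeriod σ x := by
  have h1 : Function.minimalPeriod σ x = Nat.card (MulAction.orbit (Subgroup.zpowers σ) x) := by
    have := Fintype.ofFinite (MulAction.orbit (Subgroup.zpowers σ) x)
    rw [Nat.card_eq_fintype_card]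
    exact MulAction.minimalPeriod_eq_card (a := σ) (b := x)
  rw [h1]
  refine Nat.card_congr (Equiv.subtypeEquivRight fun y => ?_)
  constructor
  · rintro ⟨i, rfl⟩
    exact ⟨⟨σ ^ i, i, rfl⟩, rfl⟩
  · rintro ⟨⟨_, i, rfl⟩, rfl⟩
    exact ⟨i, rfl⟩

theorem numCycles_eq_sum [Fintype α] (σ : Perm α) :
    (σ.numCycles : ℚ) = ∑ x, 1 / (Function.minimalPeriod σ x : ℚ) := by
  rw [numCycles, Setoid.card_quotient_eq_sum]
  exact Finset.sum_congr rfl fun x _ => by rw [card_subtype_sameCycle]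

variable [DecidableEq α]

/-- Making the dart `a` a fixed point of the vertex permutation does not decrease `mapChar`: this
adds a vertex, and if two faces are merged, then the merged face shows that no component has been
split. -/
theorem mapChar_le_mapChar_swap_mul [Finite α] (ν ι : Perm α) {a : α} (ha : ν a ≠ a) :
    mapChar ν ι ≤ mapChar (swap a (ν a) * ν) ι := by
  have hZ := numCycles_lt_numCycles_swap_mul ha.symm (SameCycle.rfl.apply_right : ν.SameCycle a (ν a))
  have hC : Nat.card (Quotient (SameCycle.setoid (swap a (ν a) * ν) ⊔ SameCycle.setoid ι)) ≤
      Nat.card (Quotient (SameCycle.setoid ν ⊔ SameCycle.setoid ι)) + 1 := by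
    refine Setoid.card_quotient_le_card_quotient_add_one _ _ a (ν a) fun x y h => ?_
    set r := SameCycle.setoid (swap a (ν a) * ν) ⊔ SameCycle.setoid ι with hr
    have hle : SameCycle.setoid ν ⊔ SameCycle.setoid ι ≤ r.merge a (ν a) := by
      refine sup_le (sameCycle_le_of_apply fun x => ?_) fun x y h => Or.inl (?_ : r x y)
      · have := rel_swap_mul_apply (σ := swap a (ν a) * ν) (a := a) (b := ν a)
          (r := r.merge a (ν a)) (fun x => Or.inl ?_) ?_ x
        · rwa [← mul_assoc, swap_mul_self, one_mul] at this
        · exact (le_sup_left : _ ≤ r) SameCycle.rfl.apply_right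
        · exact Or.inr ⟨Or.inl (r.refl' _), Or.inr (r.refl' _)⟩
      · exact (le_sup_right : _ ≤ r) h
    exact hle h
  unfold mapChar
  rw [mul_assoc]
  by_cases hs : (ν * ι).SameCycle a (ν a)
  · have hF := numCycles_lt_numCycles_swap_mul ha.symm hs
    omega
  · have hF := numCycles_le_numCycles_swap_mul_add_one (ν * ι) a (ν a)
    have hs' := sameCycle_swap_mul hs
    have hC' : Nat.card (Quotient (SameCycle.setoid (swap a (ν a) * ν) ⊔ SameCycle.setoid ι)) ≤
        Nat.card (Quotient (SameCycle.setoid ν ⊔ SameCycle.setoid ι)) := by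
      refine Setoid.card_quotient_le_of_le (sup_le (sameCycle_le_of_apply fun x => ?_) le_sup_right)
      set r := SameCycle.setoid (swap a (ν a) * ν) ⊔ SameCycle.setoid ι with hr
      have h1 : ∀ x, r x ((swap a (ν a) * ν) x) := fun x =>
        (le_sup_left : _ ≤ r) SameCycle.rfl.apply_right
      have h2 : ∀ x, r x (ι x) := fun x => (le_sup_right : _ ≤ r) SameCycle.rfl.apply_right
      have h3 : r a (ν a) := by
        rw [← mul_assoc] at hs'
        exact sameCycle_le_of_apply (fun x => r.trans' (h2 x) (h1 (ι x))) hs'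
      have := rel_swap_mul_apply h1 h3 x
      rwa [← mul_assoc, swap_mul_self, one_mul] at this
    omega

theorem sameCycle_swap_apply_mul [Finite α] {ν : Perm α} {a d e : α} (hd : d ≠ a) (he : e ≠ a)
    (h : ν.SameCycle d e) : (swap a (ν a) * ν).SameCycle d e := by
  by_cases ha : ν a = a
  · rwa [ha, swap_self, ← Perm.one_def, one_mul]
  have key : ∀ n : ℕ, ((ν ^ n) d ≠ a → (swap a (ν a) * ν).SameCycle d ((ν ^ n) d)) ∧
      ((ν ^ n) d = a → (swap a (ν a) * ν).SameCycle d (ν a)) := by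
    intro n
    induction n with
    | zero => exact ⟨fun _ => SameCycle.rfl, fun h => absurd h hd⟩
    | succ n ih =>
      rw [pow_succ', mul_apply]
      generalize (ν ^ n) d = x at ih ⊢
      by_cases hx : x = a
      · subst hx
        exact ⟨fun _ => ih.2 rfl, fun h => absurd h ha⟩
      · have h1 := (ih.1 hx).apply_right
        rw [mul_apply] at h1
        refine ⟨fun h => ?_, fun h => ?_⟩
        · rwa [swap_apply_of_ne_of_ne h (fun h' => hx (ν.injective h'))] at h1
        · rwa [h, swap_apply_left] at h1
  obtain ⟨n, rfl⟩ := h.exists_nat_pow_eq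
  exact (key n).1 he

/-- Detaching a set `X` of darts: every dart of `X` becomes a vertex of its own, the cyclic orders of
the other darts are kept, and `mapChar` does not decrease. -/
theorem exists_detach [Finite α] (ν ι : Perm α) (X : Finset α) :
    ∃ ν' : Perm α, (∀ d ∈ X, ν' d = d) ∧
      (∀ d e, d ∉ X → e ∉ X → ν.SameCycle d e → ν'.SameCycle d e) ∧
      SameCycle.setoid ν' ≤ SameCycle.setoid ν ∧ mapChar ν ι ≤ mapChar ν' ι := by
  induction X using Finset.induction_on with
  | empty => exact ⟨ν, by simp, fun d e _ _ h => h, le_rfl, le_rfl⟩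
  | insert a X haX ih =>
    obtain ⟨μ, h1, h2, h3, h4⟩ := ih
    refine ⟨swap a (μ a) * μ, ?_, ?_, ?_, ?_⟩
    · intro d hd
      rw [mul_apply]
      rcases eq_or_ne d a with rfl | hda
      · rw [swap_apply_right]
      · have hd' := h1 d ((Finset.mem_insert.1 hd).resolve_left hda)
        rw [hd']
        refine swap_apply_of_ne_of_ne hda fun h => hda (μ.injective (hd'.trans h))
    · intro d e hd he h
      rw [Finset.mem_insert, not_or] at hd he
      exact sameCycle_swap_apply_mul hd.1 he.1 (h2 d e hd.2 he.2 h)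
    · refine le_trans (sameCycle_le_of_apply ?_) h3
      exact rel_swap_mul_apply (r := SameCycle.setoid μ) (fun x => SameCycle.rfl.apply_right)
        SameCycle.rfl.apply_right
    · by_cases ha : μ a = a
      · rwa [ha, swap_self, ← Perm.one_def, one_mul]
      · exact h4.trans (mapChar_le_mapChar_swap_mul μ ι ha)

end Equiv.Perm

/-! ### Euler's formula for subgraphs of planar graphs -/

namespace SimpleGraph

variable {V : Type*} {G H : SimpleGraph V}

theorem RotationSystem.sameCycle_next_iff (R : G.RotationSystem) (d e : G.Dart) :
    R.next.SameCycle d e ↔ d.fst = e.fst :=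
  ⟨fun h => Equiv.Perm.sameCycle_le_of_apply (r := Setoid.ker fun d : G.Dart => d.fst)
    (fun x => (R.fst_next x).symm) h, R.sameCycle_next d e⟩

theorem RotationSystem.facePerm_apply (R : G.RotationSystem) (d : G.Dart) :
    R.facePerm d = R.next d.symm := rfl

theorem RotationSystem.fst_facePerm (R : G.RotationSystem) (d : G.Dart) :
    (R.facePerm d).fst = d.snd :=
  R.fst_next d.symm

theorem RotationSystem.minimalPeriod_next [Fintype V] [DecidableRel G.Adj]
    (R : G.RotationSystem) (d : G.Dart) :
    Function.minimalPeriod R.next d = G.degree d.fst := by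
  classical
  rw [← Equiv.Perm.card_subtype_sameCycle, ← dart_fst_fiber_card_eq_degree,
    Nat.card_eq_fintype_card, Fintype.card_subtype]
  congr 1
  ext e
  simp only [Finset.mem_filter, Finset.mem_univ, true_and]
  exact (R.sameCycle_next_iff d e).trans eq_comm

theorem Reachable.eq_of_isolated {v w : V} (h : G.Reachable v w) (hv : ∀ w, ¬ G.Adj v w) :
    v = w := by
  obtain ⟨p⟩ := h
  cases p with
  | nil => rfl
  | cons h _ => exact absurd h (hv _)

/-- Isolated vertices contribute nothing to the Euler characteristic of the map formed by the
darts, as each of them has a vertex, a face and a component of its own. -/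
theorem RotationSystem.card_edgeSet_le_mapChar [Finite V] (R : G.RotationSystem)
    (hR : Nat.card V + Nat.card R.Face = Nat.card G.edgeSet + 2 * Nat.card G.ConnectedComponent) :
    (Nat.card G.edgeSet : ℤ) ≤ R.next.mapChar (Dart.symm_involutive (G := G)).toPerm := by
  classical
  have hfinD : Finite G.Dart := Finite.of_injective _ Dart.toProd_injective
  set ι := (Dart.symm_involutive (G := G)).toPerm with hι
  set I := {v : V // ∀ w, ¬ G.Adj v w} with hI
  have hF : Nat.card R.Face = (R.next * ι).numCycles + Nat.card I := Nat.card_sum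
  have hV : Nat.card V ≤ R.next.numCycles + Nat.card I := by
    rw [Equiv.Perm.numCycles, ← Nat.card_sum]
    refine Nat.card_le_card_of_surjective (Sum.elim (Quotient.lift (fun d => d.fst)
      fun d e h => (R.sameCycle_next_iff d e).1 h) Subtype.val) fun v => ?_
    by_cases hv : ∀ w, ¬ G.Adj v w
    · exact ⟨Sum.inr ⟨v, hv⟩, rfl⟩
    · push Not at hv
      obtain ⟨w, hw⟩ := hv
      exact ⟨Sum.inl (Quotient.mk _ ⟨(v, w), hw⟩), rfl⟩
  set r := Equiv.Perm.SameCycle.setoid R.next ⊔ Equiv.Perm.SameCycle.setoid ι with hr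
  have hnext : ∀ d e : G.Dart, d.fst = e.fst → r d e := fun d e h =>
    (le_sup_left : _ ≤ r) (R.sameCycle_next d e h)
  have hsymm : ∀ d : G.Dart, r d d.symm := fun d =>
    (le_sup_right : _ ≤ r) (Equiv.Perm.SameCycle.rfl.apply_right : ι.SameCycle d (ι d))
  have hwalk : ∀ {u v : V} (p : G.Walk u v) (d e : G.Dart), d.fst = u → e.fst = v → r d e := by
    intro u v p
    induction p with
    | nil => exact fun d e hd he => hnext d e (hd.trans he.symm)
    | cons h p ih =>
      intro d e hd he
      exact r.trans' (r.trans' (hnext d ⟨(_, _), h⟩ hd) (hsymm _)) (ih _ e rfl he)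
  have hrle : r ≤ Setoid.ker fun d : G.Dart => G.connectedComponentMk d.fst := by
    refine sup_le (Equiv.Perm.sameCycle_le_of_apply fun d => ?_)
      (Equiv.Perm.sameCycle_le_of_apply fun d => ?_)
    · exact congrArg _ (R.fst_next d).symm
    · exact ConnectedComponent.sound d.adj.reachable
  have hC : Nat.card (Quotient r) + Nat.card I ≤ Nat.card G.ConnectedComponent := by
    rw [← Nat.card_sum]
    refine Nat.card_le_card_of_injective (Sum.elim (Quotient.lift
      (fun d => G.connectedComponentMk d.fst) fun d e h => hrle h)
      fun v => G.connectedComponentMk v.1) ?_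
    rintro (⟨⟨d⟩⟩ | ⟨v, hv⟩) (⟨⟨e⟩⟩ | ⟨w, hw⟩) h
    · obtain ⟨p⟩ := ConnectedComponent.exact h
      exact congrArg Sum.inl (Quotient.sound (hwalk p d e rfl rfl))
    · have h' := (ConnectedComponent.exact h).symm.eq_of_isolated hw
      exact absurd d.adj (by rw [← h']; exact hw _)
    · have h' := (ConnectedComponent.exact h).eq_of_isolated hv
      exact absurd e.adj (by rw [← h']; exact hv _)
    · exact congrArg Sum.inr (Subtype.ext ((ConnectedComponent.exact h).eq_of_isolated hv))
  rw [Equiv.Perm.mapChar, ← hr]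
  omega

/-- Euler's formula for a subgraph `H` of a planar graph, as an inequality and summed over darts:
each dart carries its share of a vertex, of a face, and of an edge. -/
theorem IsPlanar.exists_rotationSystem [Fintype V] [DecidableRel H.Adj] (hG : G.IsPlanar)
    (hle : H ≤ G) (hne : Nonempty H.Dart) :
    ∃ R : H.RotationSystem, 0 < ∑ d : H.Dart,
      (1 / (H.degree d.fst : ℚ) + 1 / (Function.minimalPeriod R.facePerm d : ℚ) - 1 / 2) := by
  classical
  obtain ⟨R, hR⟩ := hG
  set ι := (Dart.symm_involutive (G := G)).toPerm with hι
  have hιd : ∀ d, ι d = d.symm := fun d => rfl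
  set X : Finset G.Dart := Finset.univ.filter fun d => ¬ H.Adj d.fst d.snd with hX
  have hmem : ∀ d, d ∈ X ↔ ¬ H.Adj d.fst d.snd := fun d => by simp [hX]
  have hmem_symm : ∀ d, d.symm ∈ X ↔ d ∈ X := fun d => by
    rw [hmem, hmem]
    exact not_congr (H.adj_comm _ _)
  obtain ⟨ν, hfix, hcyc, hsub, hchar⟩ := R.next.exists_detach ι X
  replace hchar := (R.card_edgeSet_le_mapChar hR).trans hchar
  have hfst : ∀ d, (ν d).fst = d.fst := fun d =>
    (((R.sameCycle_next_iff d (ν d)).1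
      (hsub (Equiv.Perm.SameCycle.rfl.apply_right : ν.SameCycle d (ν d))))).symm
  have hνmem : ∀ d, ν d ∉ X ↔ d ∉ X := fun d => not_congr
    ⟨fun h => by rw [← ν.injective (hfix _ h)]; exact h, fun h => by rw [hfix d h]; exact h⟩
  -- the map on the darts of `H`
  let e : H.Dart ≃ {d : G.Dart // d ∉ X} :=
    { toFun := fun d => ⟨⟨d.toProd, hle d.adj⟩, by rw [hmem, not_not]; exact d.adj⟩
      invFun := fun d => ⟨d.1.toProd, by have := d.2; rwa [hmem, not_not] at this⟩
      left_inv := fun d => rfl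
      right_inv := fun d => rfl }
  let j : H.Dart → G.Dart := fun d => (e d).1
  have hj : Function.Injective j := Subtype.val_injective.comp e.injective
  let μ : Equiv.Perm H.Dart := e.symm.permCongr (ν.subtypePerm hνmem)
  have hμ : ∀ d, j (μ d) = ν (j d) := fun d => by
    simp [j, μ, Equiv.permCongr_apply]
  have hμpow : ∀ (n : ℕ) d, j ((μ ^ n) d) = (ν ^ n) (j d) := by
    intro n
    induction n with
    | zero => exact fun d => rfl
    | succ n ih =>
      intro d
      rw [pow_succ', Equiv.Perm.mul_apply, hμ, ih, pow_succ', Equiv.Perm.mul_apply]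
  let S : H.RotationSystem :=
    { next := μ
      fst_next := fun d => (congrArg (fun d : G.Dart => d.fst) (hμ d)).trans (hfst (j d))
      sameCycle_next := fun d d' h => by
        obtain ⟨n, hn⟩ := (hcyc (j d) (j d') (e d).2 (e d').2
          (R.sameCycle_next _ _ h)).exists_nat_pow_eq
        exact ⟨n, hj (by rw [zpow_natCast, hμpow, hn])⟩ }
  refine ⟨S, ?_⟩
  have hper : ∀ {f : H.Dart → H.Dart} {g : G.Dart → G.Dart} (_ : ∀ d, j (f d) = g (j d))
      (d : H.Dart), Function.minimalPeriod g (j d) = Function.minimalPeriod f d := by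
    intro f g hfg d
    rw [Function.minimalPeriod_eq_minimalPeriod_iff]
    intro n
    have : g^[n] (j d) = j (f^[n] d) :=
      ((Function.Semiconj.iterate_right (show Function.Semiconj j f g from hfg) n) d).symm
    unfold Function.IsPeriodicPt Function.IsFixedPt
    rw [this, hj.eq_iff]
  have hface : ∀ d, j (S.facePerm d) = (ν * ι) (j d) := fun d => hμ d.symm
  -- the two darts of a deleted edge form a component
  set r := Equiv.Perm.SameCycle.setoid ν ⊔ Equiv.Perm.SameCycle.setoid ι with hr
  have hrX : ∀ d ∈ X, (1 : ℚ) / 2 ≤ 1 / (Nat.card {y // r d y} : ℚ) := by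
    intro d hd
    have hle' : r ≤ Setoid.ker fun d : G.Dart => if d ∈ X then some d.edge else none := by
      refine sup_le (Equiv.Perm.sameCycle_le_of_apply fun x => ?_)
        (Equiv.Perm.sameCycle_le_of_apply fun x => ?_)
      · by_cases hx : x ∈ X
        · rw [hfix x hx]
        · simp [Setoid.ker_def, hx, hνmem x]
      · simp [Setoid.ker_def, hιd, hmem_symm]
    have hcard : Nat.card {y // r d y} ≤ 2 := by
      have hsub : ({y | r d y} : Set G.Dart) ⊆ {d, d.symm} := by
        intro y hy
        have h := Setoid.ker_def.1 (hle' hy)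
        rw [if_pos hd] at h
        by_cases hyX : y ∈ X
        · rw [if_pos hyX, Option.some.injEq] at h
          exact dart_edge_eq_iff _ _ |>.1 h.symm
        · rw [if_neg hyX] at h
          cases h
      calc Nat.card {y // r d y} = Set.ncard {y | r d y} := rfl
        _ ≤ _ := Set.ncard_le_ncard hsub
        _ ≤ 2 := (Set.ncard_insert_le _ _).trans (by rw [Set.ncard_singleton])
    have hpos : 0 < Nat.card {y // r d y} := Nat.card_pos_iff.2 ⟨⟨⟨d, r.refl' d⟩⟩, inferInstance⟩
    exact one_div_le_one_div_of_le (by exact_mod_cast hpos) (by exact_mod_cast hcard)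
  have hfaceX : ∀ d ∈ X, (1 : ℚ) / (Function.minimalPeriod (ν * ι) d : ℚ) ≤ 1 / 2 := by
    intro d hd
    have h1 : Function.minimalPeriod (ν * ι) d ≠ 1 := by
      rw [Ne, Function.minimalPeriod_eq_one_iff_isFixedPt, Function.IsFixedPt,
        Equiv.Perm.mul_apply, hιd, hfix _ ((hmem_symm d).2 hd)]
      exact d.symm_ne
    rcases Nat.eq_zero_or_pos (Function.minimalPeriod (ν * ι) d) with h0 | h0
    · rw [h0]; norm_num
    · exact one_div_le_one_div_of_le (by norm_num) (by exact_mod_cast (by omega : 2 ≤ _))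
  have hrpos : ∀ d, (0 : ℚ) < 1 / (Nat.card {y // r d y} : ℚ) := fun d =>
    one_div_pos.2 (Nat.cast_pos.2 (Nat.card_pos_iff.2 ⟨⟨⟨d, r.refl' d⟩⟩, inferInstance⟩))
  have htotal : (∑ d : G.Dart, (1 / 2 : ℚ)) ≤ ∑ d : G.Dart,
      (1 / (Function.minimalPeriod ν d : ℚ) + 1 / (Function.minimalPeriod (ν * ι) d : ℚ)
        - 2 * (1 / (Nat.card {y // r d y} : ℚ))) := by
    rw [Finset.sum_sub_distrib, Finset.sum_add_distrib, ← Finset.mul_sum,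
      ← Equiv.Perm.numCycles_eq_sum, ← Equiv.Perm.numCycles_eq_sum, ← Setoid.card_quotient_eq_sum,
      Finset.sum_const, Finset.card_univ, dart_card_eq_twice_card_edges]
    rw [Nat.card_eq_fintype_card, ← edgeFinset_card] at hchar
    rw [Equiv.Perm.mapChar, ← hr] at hchar
    have h : ((G.edgeFinset.card : ℤ) : ℚ) ≤ _ := Int.cast_le.2 hchar
    push_cast at h
    simp only [nsmul_eq_mul]
    push_cast
    linarith
  rw [← Finset.sum_add_sum_compl X, ← Finset.sum_add_sum_compl X] at htotal
  have hXsum : ∑ d ∈ X, (1 / (Function.minimalPeriod ν d : ℚ)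
      + 1 / (Function.minimalPeriod (ν * ι) d : ℚ) - 2 * (1 / (Nat.card {y // r d y} : ℚ))) ≤
      ∑ d ∈ X, (1 / 2 : ℚ) := by
    refine Finset.sum_le_sum fun d hd => ?_
    rw [Function.minimalPeriod_eq_one_iff_isFixedPt.2 (hfix d hd)]
    have h1 := hrX d hd
    have h2 := hfaceX d hd
    rw [Nat.cast_one, div_one]
    linarith
  have hcompl : ∀ F : G.Dart → ℚ, ∑ d ∈ Xᶜ, F d = ∑ d : H.Dart, F (j d) := by
    intro F
    rw [← Finset.sum_coe_sort Xᶜ F]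
    refine (Fintype.sum_equiv (e.trans (Equiv.subtypeEquivRight fun d => by simp)) _ _ ?_).symm
    intro d
    rfl
  have hlt : ∑ d ∈ Xᶜ, (1 / 2 : ℚ) < ∑ d ∈ Xᶜ, (1 / (Function.minimalPeriod ν d : ℚ)
      + 1 / (Function.minimalPeriod (ν * ι) d : ℚ)) := by
    refine lt_of_le_of_lt (by linarith) (Finset.sum_lt_sum_of_nonempty ?_ (f := fun d =>
      (1 / (Function.minimalPeriod ν d : ℚ) + 1 / (Function.minimalPeriod (ν * ι) d : ℚ)
        - 2 * (1 / (Nat.card {y // r d y} : ℚ)))) fun d _ => ?_)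
    · obtain ⟨d⟩ := hne
      exact ⟨j d, Finset.mem_compl.2 (e d).2⟩
    · linarith [hrpos d]
  rw [hcompl, hcompl] at hlt
  rw [Finset.sum_sub_distrib, sub_pos]
  refine hlt.trans_eq (Finset.sum_congr rfl fun d _ => ?_)
  rw [hper hμ, hper hface, show μ = S.next from rfl, S.minimalPeriod_next]

end SimpleGraph

/-! ### Faces in graphs without 4-cycles -/

namespace SimpleGraph

variable {V : Type*} {G H : SimpleGraph V}

theorem HasNoCycleOfLength.false_of_adj (h4 : G.HasNoCycleOfLength 4) {a b c d : V}
    (hab : G.Adj a b) (hbc : G.Adj b c) (hcd : G.Adj c d) (hda : G.Adj d a) (hac : a ≠ c)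
    (hbd : b ≠ d) : False := by
  refine h4 a (.cons hab (.cons hbc (.cons hcd (.cons hda .nil)))) ?_ rfl
  simp [Walk.cons_isCycle_iff, Walk.cons_isPath_iff, hab.ne, hbc.ne, hcd.ne, hda.ne, hac, hbd,
    hab.ne', hda.ne', hac.symm]

namespace RotationSystem

variable (R : H.RotationSystem)

theorem snd_facePerm_ne [Fintype V] [DecidableRel H.Adj] {d : H.Dart} (hd : H.degree d.snd ≠ 1) :
    (R.facePerm d).snd ≠ d.fst := by
  intro h
  apply hd
  rw [show d.snd = d.symm.fst from rfl, ← R.minimalPeriod_next,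
    Function.minimalPeriod_eq_one_iff_isFixedPt]
  exact Dart.ext _ _ (Prod.ext (R.fst_facePerm d) h)

theorem minimalPeriod_facePerm_pos [Finite V] (d : H.Dart) :
    0 < Function.minimalPeriod R.facePerm d := by
  have : Finite H.Dart := Finite.of_injective _ Dart.toProd_injective
  rw [← Equiv.Perm.card_subtype_sameCycle]
  exact Nat.card_pos_iff.2 ⟨⟨⟨d, Equiv.Perm.SameCycle.rfl⟩⟩, inferInstance⟩

theorem snd_facePerm_facePerm {d : H.Dart} (hd : Function.minimalPeriod R.facePerm d = 3) :
    (R.facePerm (R.facePerm d)).snd = d.fst := by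
  have h := Function.isPeriodicPt_minimalPeriod R.facePerm d
  rw [hd] at h
  rw [← R.fst_facePerm]
  exact congrArg (fun d : H.Dart => d.fst) h

/-- As no vertex has degree one, facial walks do not turn back, so a face of length four would be a
4-cycle. -/
theorem minimalPeriod_facePerm [Fintype V] [DecidableRel H.Adj] (h4 : H.HasNoCycleOfLength 4)
    (hdeg : ∀ v, H.degree v ≠ 1) (d : H.Dart) :
    Function.minimalPeriod R.facePerm d = 3 ∨ 5 ≤ Function.minimalPeriod R.facePerm d := by
  have hpos := R.minimalPeriod_facePerm_pos d
  have h := Function.isPeriodicPt_minimalPeriod R.facePerm d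
  have hback : ∀ d, (R.facePerm d).snd ≠ d.fst := fun d => R.snd_facePerm_ne (hdeg _)
  by_contra hcon
  have hcases : Function.minimalPeriod R.facePerm d = 1 ∨ Function.minimalPeriod R.facePerm d = 2 ∨
    Function.minimalPeriod R.facePerm d = 4 := by omega
  rcases hcases with h' | h' | h' <;> rw [h'] at h
  · have h1 : (R.facePerm d).fst = d.fst := congrArg (fun d : H.Dart => d.fst) h
    exact d.snd_ne_fst (R.fst_facePerm d ▸ h1)
  · have h1 : (R.facePerm (R.facePerm d)).fst = d.fst := congrArg (fun d : H.Dart => d.fst) h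
    exact hback d (R.fst_facePerm _ ▸ h1)
  · have h1 : (R.facePerm (R.facePerm (R.facePerm (R.facePerm d)))).fst = d.fst :=
      congrArg (fun d : H.Dart => d.fst) h
    set d1 := R.facePerm d with hd1
    set d2 := R.facePerm d1 with hd2
    set d3 := R.facePerm d2 with hd3
    have e1 : d1.fst = d.snd := R.fst_facePerm d
    have e2 : d2.fst = d1.snd := R.fst_facePerm d1
    have e3 : d3.fst = d2.snd := R.fst_facePerm d2
    have e4 : d3.snd = d.fst := (R.fst_facePerm d3).symm.trans h1
    have a0 : H.Adj d.fst d1.fst := by rw [e1]; exact d.adj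
    have a1 : H.Adj d1.fst d2.fst := by rw [e2]; exact d1.adj
    have a2 : H.Adj d2.fst d3.fst := by rw [e3]; exact d2.adj
    have a3 : H.Adj d3.fst d.fst := by rw [← e4]; exact d3.adj
    exact h4.false_of_adj a0 a1 a2 a3 (by rw [e2]; exact (hback d).symm)
      (by rw [e3]; exact (hback d1).symm)

end RotationSystem

theorem HasNoCycleOfLength.mono {n : ℕ} (h : G.HasNoCycleOfLength n) (hle : H ≤ G) :
    H.HasNoCycleOfLength n := fun v c hc hn =>
  h v (c.mapLe hle) (hc.mapLe hle) (by rw [← hn]; simp)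

/-! ### Sums over darts -/

theorem sum_dart_fst [Fintype V] [DecidableRel H.Adj] (F : V → ℚ) :
    ∑ d : H.Dart, F d.fst = ∑ v, H.degree v * F v := by
  classical
  rw [← Finset.sum_fiberwise (g := fun d : H.Dart => d.fst)]
  refine Finset.sum_congr rfl fun v _ => ?_
  rw [← H.dart_fst_fiber_card_eq_degree, ← nsmul_eq_mul, ← Finset.sum_const]
  exact Finset.sum_congr rfl fun d hd => by rw [(Finset.mem_filter.1 hd).2]

/-- Charge may be moved between the two darts of an edge. -/
theorem sum_dart_le_sum_dart [Fintype V] [DecidableRel H.Adj] {F K : H.Dart → ℚ}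
    (h : ∀ d, F d + F d.symm ≤ K d + K d.symm) : ∑ d, F d ≤ ∑ d, K d := by
  have hsymm : ∀ F : H.Dart → ℚ, ∑ d : H.Dart, F d.symm = ∑ d, F d := fun F =>
    Equiv.sum_comp (Dart.symm_involutive (G := H)).toPerm F
  have := Finset.sum_le_sum fun d (_ : d ∈ Finset.univ) => h d
  rw [Finset.sum_add_distrib, Finset.sum_add_distrib, hsymm, hsymm] at this
  linarith

/-! ### Vertices with two neighbours in a given set -/

/-- Without 4-cycles, two vertices of `B` have at most one common neighbour, so the vertices of `A`
are essentially the edges of a simple planar graph on `B`. -/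
theorem IsPlanar.card_le_three_mul_card [Fintype V] [DecidableEq V] [DecidableRel G.Adj]
    (hG : G.IsPlanar) (h4 : G.HasNoCycleOfLength 4) (B : Finset V) :
    ∀ A : Finset V, Disjoint A B → (∀ a ∈ A, 2 ≤ (B.filter (G.Adj a)).card) →
      A.card ≤ 3 * B.card := by
  induction B using Finset.strongInduction with
  | H B ih =>
  intro A hAB hA
  rcases A.eq_empty_or_nonempty with rfl | hne
  · simp
  by_cases hb : ∃ b ∈ B, (A.filter (G.Adj b)).card ≤ 1
  · obtain ⟨b, hbB, hb⟩ := hb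
    have h1 := ih (B.erase b) (Finset.erase_ssubset hbB) (A.filter fun a => ¬ G.Adj b a)
      (hAB.mono (Finset.filter_subset _ _) (Finset.erase_subset _ _)) (by
        intro a ha
        obtain ⟨haA, hba⟩ := Finset.mem_filter.1 ha
        have : (B.erase b).filter (G.Adj a) = B.filter (G.Adj a) := by
          ext x
          simp only [Finset.mem_filter, Finset.mem_erase]
          exact ⟨fun h => ⟨h.1.2, h.2⟩, fun h =>
            ⟨⟨fun hx => hba (hx ▸ h.2.symm), h.1⟩, h.2⟩⟩
        rw [this]
        exact hA a haA)
    have h2 := Finset.card_filter_add_card_filter_not (s := A) (G.Adj b)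
    rw [Finset.card_erase_of_mem hbB] at h1
    have := Finset.card_pos.2 ⟨b, hbB⟩
    omega
  push Not at hb
  let H : SimpleGraph V :=
    { Adj := fun u v => G.Adj u v ∧ (u ∈ A ∧ v ∈ B ∨ u ∈ B ∧ v ∈ A)
      symm := ⟨fun u v h => ⟨h.1.symm, h.2.symm.imp And.symm And.symm⟩⟩
      loopless := ⟨fun u h => G.loopless.irrefl u h.1⟩ }
  have hdec : DecidableRel H.Adj := fun u v => inferInstanceAs (Decidable (_ ∧ _))
  have hle : H ≤ G := fun u v h => h.1
  have hdisj : ∀ v, v ∈ A → v ∈ B → False := fun v h h' => Finset.disjoint_left.1 hAB h h'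
  have hdegA : ∀ a ∈ A, 2 ≤ H.degree a := fun a ha => by
    refine (hA a ha).trans (Finset.card_le_card fun b hb => ?_)
    rw [Finset.mem_filter] at hb
    exact (H.mem_neighborFinset _ _).2 ⟨hb.2, Or.inl ⟨ha, hb.1⟩⟩
  have hdegB : ∀ b ∈ B, 2 ≤ H.degree b := fun b hbB => by
    refine Nat.succ_le_of_lt (hb b hbB) |>.trans (Finset.card_le_card fun a ha => ?_)
    rw [Finset.mem_filter] at ha
    exact (H.mem_neighborFinset _ _).2 ⟨ha.2, Or.inr ⟨hbB, ha.1⟩⟩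
  have hdeg0 : ∀ v, v ∉ A → v ∉ B → H.degree v = 0 := fun v hvA hvB => by
    rw [← Nat.le_zero, ← not_lt]
    intro h
    obtain ⟨w, hw⟩ := (H.degree_pos_iff_exists_adj v).1 h
    exact hw.2.elim (fun h => hvA h.1) (fun h => hvB h.1)
  have hdeg1 : ∀ v, H.degree v ≠ 1 := fun v => by
    by_cases hvA : v ∈ A
    · have := hdegA v hvA; omega
    by_cases hvB : v ∈ B
    · have := hdegB v hvB; omega
    rw [hdeg0 v hvA hvB]; norm_num
  have hflip : ∀ d : H.Dart, d.snd ∈ A ↔ d.fst ∉ A := fun d =>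
    d.adj.2.elim (fun h => ⟨fun h' => (hdisj _ h' h.2).elim, fun h' => absurd h.1 h'⟩)
      (fun h => ⟨fun _ h' => hdisj _ h' h.1, fun _ => h.2⟩)
  have hdart : Nonempty H.Dart := by
    obtain ⟨a, ha⟩ := hne
    obtain ⟨w, hw⟩ := (H.degree_pos_iff_exists_adj a).1 (by have := hdegA a ha; omega)
    exact ⟨⟨(a, w), hw⟩⟩
  obtain ⟨R, hR⟩ := hG.exists_rotationSystem hle hdart
  have hface : ∀ d, 6 ≤ Function.minimalPeriod R.facePerm d := by
    intro d
    have hstep : ∀ d, (R.facePerm d).fst ∈ A ↔ d.fst ∉ A := fun d => by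
      rw [R.fst_facePerm, hflip]
    -- the facial walks alternate between `A` and `B`
    have hodd : ∀ n d, (R.facePerm^[2 * n + 1] d).fst ∈ A ↔ d.fst ∉ A := by
      intro n
      induction n with
      | zero => exact hstep
      | succ n ih =>
        intro d
        rw [show 2 * (n + 1) + 1 = 2 * n + 1 + 1 + 1 by ring, Function.iterate_succ_apply,
          Function.iterate_succ_apply, ih, hstep, hstep, not_not]
    have hne : ∀ n, Function.minimalPeriod R.facePerm d ≠ 2 * n + 1 := fun n hn => by
      have h := Function.isPeriodicPt_minimalPeriod R.facePerm d
      rw [hn] at h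
      have := hodd n d
      rw [show R.facePerm^[2 * n + 1] d = d from h] at this
      exact iff_not_self this
    have h1 := R.minimalPeriod_facePerm (h4.mono hle) hdeg1 d
    have h2 := hne 1
    have h3 := hne 2
    omega
  have hsum : ∑ d : H.Dart, (1 / (H.degree d.fst : ℚ)
      + 1 / (Function.minimalPeriod R.facePerm d : ℚ) - 1 / 2) ≤
      ∑ d : H.Dart, (1 / (H.degree d.fst : ℚ) + if d.fst ∈ A then (-2 / 3 : ℚ) else 0) := by
    refine sum_dart_le_sum_dart fun d => ?_
    have h1 : ∀ d, 1 / (Function.minimalPeriod R.facePerm d : ℚ) ≤ 1 / 6 := fun d =>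
      one_div_le_one_div_of_le (by norm_num) (by exact_mod_cast hface d)
    have h2 := h1 d
    have h3 := h1 d.symm
    have h4 : ((if d.fst ∈ A then (-2 / 3 : ℚ) else 0) +
        if d.symm.fst ∈ A then (-2 / 3 : ℚ) else 0) = -2 / 3 := by
      have := hflip d
      rw [show d.symm.fst = d.snd from rfl]
      by_cases h : d.fst ∈ A <;> simp [this, h]
    linarith
  replace hsum := hR.trans_le hsum
  rw [sum_dart_fst fun v => 1 / (H.degree v : ℚ) + if v ∈ A then (-2 / 3 : ℚ) else 0] at hsum
  have hbound : ∀ v, (H.degree v : ℚ) * (1 / (H.degree v : ℚ) + if v ∈ A then (-2 / 3 : ℚ) else 0) ≤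
      (if v ∈ A then (-1 / 3 : ℚ) else 0) + if v ∈ B then 1 else 0 := by
    intro v
    by_cases hvA : v ∈ A
    · have h2 : (2 : ℚ) ≤ H.degree v := by exact_mod_cast hdegA v hvA
      rw [if_pos hvA, if_pos hvA, if_neg fun h => hdisj v hvA h, mul_add, mul_one_div_cancel (by linarith)]
      linarith
    by_cases hvB : v ∈ B
    · have h2 : (2 : ℚ) ≤ H.degree v := by exact_mod_cast hdegB v hvB
      rw [if_neg hvA, if_neg hvA, if_pos hvB, add_zero, mul_one_div_cancel (by linarith)]
      norm_num
    · simp [hdeg0 v hvA hvB, hvA, hvB]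
  replace hsum := hsum.trans_le (Finset.sum_le_sum fun v _ => hbound v)
  rw [Finset.sum_add_distrib, Finset.sum_ite_mem, Finset.sum_ite_mem, Finset.univ_inter,
    Finset.univ_inter, Finset.sum_const, Finset.sum_const, nsmul_eq_mul, nsmul_eq_mul] at hsum
  have : (A.card : ℚ) ≤ ((3 * B.card : ℕ) : ℚ) := by
    push_cast
    linarith
  exact_mod_cast this

end SimpleGraph

/-! ### Discharging -/

namespace SimpleGraph

variable {V : Type*} {G H : SimpleGraph V}

theorem RotationSystem.adj_of_minimalPeriod_eq_three (R : H.RotationSystem) {d : H.Dart}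
    (hd : Function.minimalPeriod R.facePerm d = 3) :
    H.Adj d.fst (R.facePerm d).snd ∧ H.Adj d.snd (R.facePerm d).snd := by
  constructor
  · have h := (R.facePerm (R.facePerm d)).adj
    rw [R.snd_facePerm_facePerm hd, R.fst_facePerm] at h
    exact h.symm
  · have h := (R.facePerm d).adj
    rwa [R.fst_facePerm] at h

/-- Without 4-cycles, only one side of an edge can be a triangular face, except if the triangle is
a component of the graph; then its vertices have degree two. -/
theorem RotationSystem.not_both_minimalPeriod_eq_three [Fintype V] [DecidableRel H.Adj]
    (R : H.RotationSystem) (h4 : H.HasNoCycleOfLength 4) {d : H.Dart} (hdeg : 3 ≤ H.degree d.fst)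
    (h1 : Function.minimalPeriod R.facePerm d = 3) :
    Function.minimalPeriod R.facePerm d.symm ≠ 3 := by
  intro h2
  obtain ⟨a1, a2⟩ := R.adj_of_minimalPeriod_eq_three h1
  obtain ⟨b1, b2⟩ := R.adj_of_minimalPeriod_eq_three h2
  by_cases hc : (R.facePerm d).snd = (R.facePerm d.symm).snd
  · have e1 : R.next d = (R.facePerm (R.facePerm d)).symm := by
      refine Dart.ext _ _ (Prod.ext ?_ ?_)
      · exact (R.fst_next d).trans (R.snd_facePerm_facePerm h1).symm
      · exact (hc.symm.trans (R.fst_facePerm _).symm)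
    have e2 : R.next (R.next d) = d := by
      rw [e1, ← R.facePerm_apply]
      have h := Function.isPeriodicPt_minimalPeriod R.facePerm d
      rw [h1] at h
      exact h
    have h3 : Function.IsPeriodicPt R.next 2 d := e2
    have h4 := h3.minimalPeriod_le (by norm_num)
    rw [R.minimalPeriod_next] at h4
    omega
  · exact h4.false_of_adj a1 a2.symm b1 b2.symm d.adj.ne hc

/-- The effect of discharging, where vertices outside `S` stand for adjacencies inside `S`. At first
a vertex of degree `d` has charge `1 - d / 3` and a face of length `l` has charge `1 - l / 6`.
A vertex of degree two outside `S` gives `1 / 6` to either neighbour. A face gives `1 / 6` to the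
initial vertex of each of its darts inside `S`, and a triangular face also gives `1 / 6` to the end
in `S` of each of its edges that leave `S`. Then no face has positive charge, and a vertex of `S` of
degree `d` has charge at most `1 - d / 6`. The sum in the statement is multiplied by six. -/
theorem IsPlanar.sum_charge_pos [Fintype V] [DecidableEq V] [DecidableRel H.Adj]
    (hG : G.IsPlanar) (h4 : G.HasNoCycleOfLength 4) (hle : H ≤ G) (S : Finset V) (hne : S.Nonempty)
    (hS : ∀ v ∈ S, 2 ≤ H.degree v)
    (hT : ∀ y ∉ S, ∀ x, H.Adj y x → x ∈ S ∧ ∃ w ∈ S, w ≠ x ∧ H.Adj y w ∧ ¬ H.Adj x w) :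
    0 < ∑ v, (if v ∈ S then 6 - (H.degree v : ℚ)
      else if 3 ≤ H.degree v then 6 - 2 * (H.degree v : ℚ) else 0) := by
  have h4' := h4.mono hle
  have hdeg1 : ∀ v, H.degree v ≠ 1 := fun v hv => by
    by_cases hvS : v ∈ S
    · have := hS v hvS; omega
    · obtain ⟨x, hx, huniq⟩ := degree_eq_one_iff_existsUnique_adj.1 hv
      obtain ⟨w, _, hwx, hw, _⟩ := (hT v hvS x hx).2
      exact hwx (huniq w hw)
  have hdart : Nonempty H.Dart := by
    obtain ⟨v, hv⟩ := hne
    obtain ⟨w, hw⟩ := (H.degree_pos_iff_exists_adj v).1 (by have := hS v hv; omega)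
    exact ⟨⟨(v, w), hw⟩⟩
  obtain ⟨R, hR⟩ := hG.exists_rotationSystem hle hdart
  set f := R.facePerm with hf
  set l : H.Dart → ℕ := fun d => Function.minimalPeriod f d with hl
  have hl35 : ∀ d, l d = 3 ∨ 5 ≤ l d := R.minimalPeriod_facePerm h4' hdeg1
  have hadj3 : ∀ d : H.Dart, l d = 3 → ∃ c, H.Adj d.fst c ∧ H.Adj d.snd c := fun d hd =>
    ⟨_, R.adj_of_minimalPeriod_eq_three hd⟩
  -- an edge outside `S` in a triangle has an end of degree at least three
  have hdeg3 : ∀ y ∉ S, ∀ x c, H.Adj y x → H.Adj y c → H.Adj x c → 3 ≤ H.degree y := by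
    intro y hy x c hyx hyc hxc
    obtain ⟨w, _, hwx, hyw, hxw⟩ := (hT y hy x hyx).2
    have hcard : ({x, c, w} : Finset V).card = 3 :=
      Finset.card_eq_three.2 ⟨x, c, w, hxc.ne, hwx.symm, fun h => hxw (h ▸ hxc), rfl⟩
    rw [← hcard]
    refine Finset.card_le_card fun z hz => (H.mem_neighborFinset _ _).2 ?_
    simp only [Finset.mem_insert, Finset.mem_singleton] at hz
    rcases hz with rfl | rfl | rfl <;> assumption
  set w : H.Dart → ℚ := fun d => if (d.fst ∈ S ∧ d.snd ∈ S) ∨ l d = 3 then 1 / 6 else 0 with hw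
  have hw0 : ∀ d, 0 ≤ w d := fun d => by
    simp only [hw]; split_ifs <;> norm_num
  have hwle : ∀ d, w d ≤ 1 / 6 := fun d => by
    simp only [hw]; split_ifs <;> norm_num
  have hface : ∑ d, 1 / (l d : ℚ) ≤ ∑ d, (1 / 6 + w d) := by
    -- faces of length five are treated as a whole: the charge is averaged along the face
    set g : H.Dart → ℚ := fun d => if l d = 5 then w d else 0 with hg
    have hlf : ∀ d (n : ℕ), l ((f ^ n) d) = l d := fun d n => by
      rw [Equiv.Perm.coe_pow]
      exact Function.minimalPeriod_apply_iterate
        (Function.minimalPeriod_pos_iff_mem_periodicPts.1 (R.minimalPeriod_facePerm_pos d)) n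
    have hgsum : ∑ d, g d = ∑ d, 1 / 5 * ∑ n ∈ Finset.range 5, g ((f ^ n) d) := by
      rw [← Finset.mul_sum, Finset.sum_comm,
        Finset.sum_congr rfl fun n _ => Equiv.sum_comp (f ^ n) g, Finset.sum_const,
        Finset.card_range, nsmul_eq_mul]
      push_cast
      ring
    have hwsum : ∑ d, (1 / 6 + w d) = ∑ d, (1 / 6 + (if l d = 5 then 0 else w d) +
        1 / 5 * ∑ n ∈ Finset.range 5, g ((f ^ n) d)) := by
      rw [Finset.sum_add_distrib (g := fun d => 1 / 5 * ∑ n ∈ Finset.range 5, g ((f ^ n) d)),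
        ← hgsum, ← Finset.sum_add_distrib]
      refine Finset.sum_congr rfl fun d _ => ?_
      simp only [hg]
      split_ifs <;> ring
    rw [hwsum]
    refine Finset.sum_le_sum fun d _ => ?_
    have hgn : ∀ n, 0 ≤ g ((f ^ n) d) := fun n => by
      simp only [hg]; split_ifs
      exacts [hw0 _, le_rfl]
    have hgs := Finset.sum_nonneg fun n (_ : n ∈ Finset.range 5) => hgn n
    rcases hl35 d with h3 | h5
    · rw [h3, if_neg (by norm_num), show w d = 1 / 6 from if_pos (Or.inr h3)]
      norm_num at hgs ⊢
      linarith
    · rcases h5.eq_or_lt with h5 | h6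
      · -- a closed walk of odd length stays in `S` for some step
        have hex : ∃ n ∈ Finset.range 5, ((f ^ n) d).fst ∈ S ∧ ((f ^ n) d).snd ∈ S := by
          by_contra hcon
          have hstep : ∀ n < 5, (((f ^ (n + 1)) d).fst ∈ S ↔ ((f ^ n) d).fst ∉ S) := by
            intro n hn
            rw [pow_succ', Equiv.Perm.mul_apply, R.fst_facePerm]
            refine ⟨fun h h' => hcon ⟨n, Finset.mem_range.2 hn, h', h⟩, fun h => ?_⟩
            exact (hT _ h _ ((f ^ n) d).adj).1
          have hper : (f ^ 5) d = d := by
            have h := Function.isPeriodicPt_minimalPeriod f d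
            rw [show Function.minimalPeriod f d = 5 from h5.symm] at h
            rw [Equiv.Perm.coe_pow]
            exact h
          have s0 := hstep 0 (by norm_num)
          have s1 := hstep 1 (by norm_num)
          have s2 := hstep 2 (by norm_num)
          have s3 := hstep 3 (by norm_num)
          have s4 := hstep 4 (by norm_num)
          simp only [Nat.reduceAdd, hper] at s0 s1 s2 s3 s4
          rw [pow_zero, Equiv.Perm.one_apply] at s0
          tauto
        obtain ⟨n, hn, hnS⟩ := hex
        have h1 : g ((f ^ n) d) = 1 / 6 := by
          simp only [hg, hw]
          rw [if_pos ((hlf d n).trans h5.symm), if_pos (Or.inl hnS)]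
        have h2 := Finset.single_le_sum (fun n (_ : n ∈ Finset.range 5) => hgn n) hn
        rw [h1] at h2
        rw [if_pos h5.symm, ← h5]
        rw [Nat.cast_ofNat]
        linarith
      · have h1 : 1 / (l d : ℚ) ≤ 1 / 6 :=
          one_div_le_one_div_of_le (by norm_num) (by exact_mod_cast h6)
        rw [if_neg h6.ne']
        linarith [hw0 d]
  set u : V → ℚ := fun v => if v ∈ S then -1 / 6 else if 3 ≤ H.degree v then -1 / 3 else -1 / 2
    with hu
  have hedge : ∑ d, (w d - 1 / 3) ≤ ∑ d : H.Dart, u d.fst := by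
    refine sum_dart_le_sum_dart fun d => ?_
    have key : ∀ d : H.Dart, d.fst ∉ S →
        (w d - 1 / 3) + (w d.symm - 1 / 3) ≤ u d.fst + u d.snd := by
      intro d hd
      have hd' := (hT _ hd _ d.adj).1
      have hu2 : u d.snd = -1 / 6 := if_pos hd'
      by_cases h3 : 3 ≤ H.degree d.fst
      · have hu1 : u d.fst = -1 / 3 := by simp only [hu]; rw [if_neg hd, if_pos h3]
        rw [hu1, hu2]
        by_cases hl3 : l d = 3
        · have : w d.symm = 0 := if_neg fun h => h.elim (fun h => hd h.2)
            (R.not_both_minimalPeriod_eq_three h4' h3 hl3)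
          linarith [hwle d]
        · have : w d = 0 := if_neg fun h => h.elim (fun h => hd h.1) hl3
          linarith [hwle d.symm]
      · have hu1 : u d.fst = -1 / 2 := by simp only [hu]; rw [if_neg hd, if_neg h3]
        have hwd : w d = 0 := if_neg fun h => h.elim (fun h => hd h.1) fun h => by
          obtain ⟨c, hc1, hc2⟩ := hadj3 d h
          exact h3 (hdeg3 _ hd _ c d.adj hc1 hc2)
        have hwd' : w d.symm = 0 := if_neg fun h => h.elim (fun h => hd h.2) fun h => by
          obtain ⟨c, hc1, hc2⟩ := hadj3 d.symm h
          exact h3 (hdeg3 _ hd _ c d.adj hc2 hc1)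
        rw [hu1, hu2, hwd, hwd']
        norm_num
    by_cases h1 : d.fst ∈ S
    · by_cases h2 : d.snd ∈ S
      · rw [show u d.fst = -1 / 6 from if_pos h1, show u d.symm.fst = -1 / 6 from if_pos h2]
        linarith [hwle d, hwle d.symm]
      · have := key d.symm h2
        rw [Dart.symm_symm] at this
        rw [show d.symm.snd = d.fst from rfl] at this
        linarith
    · exact key d h1
  have hfinal : 0 < ∑ d : H.Dart, (1 / (H.degree d.fst : ℚ) + u d.fst) := by
    rw [Finset.sum_sub_distrib, Finset.sum_add_distrib] at hR
    rw [Finset.sum_add_distrib] at hface ⊢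
    rw [Finset.sum_sub_distrib] at hedge
    simp only [Finset.sum_const, nsmul_eq_mul] at hR hface hedge
    linarith
  rw [sum_dart_fst fun v => 1 / (H.degree v : ℚ) + u v] at hfinal
  refine (mul_pos (by norm_num : (0 : ℚ) < 6) hfinal).trans_le ?_
  rw [Finset.mul_sum]
  refine Finset.sum_le_sum fun v _ => ?_
  rcases Nat.eq_zero_or_pos (H.degree v) with h0 | hpos
  · have hvS : v ∉ S := fun h => by have := hS v h; omega
    simp [h0, hvS]
  have hpos' : (0 : ℚ) < H.degree v := by exact_mod_cast hpos
  rw [mul_add, mul_one_div_cancel hpos'.ne']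
  simp only [hu]
  split_ifs with h1 h2
  · linarith
  · linarith
  · have : (2 : ℚ) ≤ H.degree v := by
      have := hdeg1 v
      exact_mod_cast (by omega : 2 ≤ H.degree v)
    linarith

end SimpleGraph

/-! ### Adjacency in the square -/

namespace SimpleGraph

variable {V : Type*} {G H : SimpleGraph V}

theorem square_adj_imp {u v : V} (h : G.square.Adj u v) :
    G.Adj u v ∨ ∃ w, G.Adj u w ∧ G.Adj w v := by
  refine h.imp_right fun h => ?_
  obtain ⟨p, hp⟩ := exists_walk_of_dist_ne_zero (by omega : G.dist u v ≠ 0)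
  rw [h] at hp
  match p, hp with
  | .cons h1 (.cons h2 .nil), _ => exact ⟨_, h1, h2⟩

/-- A minimal subgraph that keeps the adjacencies inside `S` in the square. Removing the edge from
`y ∉ S` to `x` would only affect the pairs consisting of `x` and another neighbour of `y` in `S`. -/
theorem exists_reduced_subgraph [Finite V] (G : SimpleGraph V) (S : Set V) :
    ∃ H ≤ G, (∀ u ∈ S, ∀ v ∈ S, G.square.Adj u v → H.Adj u v ∨ ∃ w, H.Adj u w ∧ H.Adj w v) ∧
      ∀ y ∉ S, ∀ x, H.Adj y x → x ∈ S ∧ ∃ w ∈ S, w ≠ x ∧ H.Adj y w ∧ ¬ H.Adj x w := by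
  obtain ⟨H, hle, ⟨hH, hmin⟩⟩ := exists_minimal_le_of_wellFoundedLT
    (fun H : SimpleGraph V => ∀ u ∈ S, ∀ v ∈ S, G.square.Adj u v →
      H.Adj u v ∨ ∃ w, H.Adj u w ∧ H.Adj w v) G fun u _ v _ => square_adj_imp
  refine ⟨H, hle, hH, fun y hy x hyx => ?_⟩
  by_contra hcon
  have hx : ∀ w ∈ S, x ∈ S → w ≠ x → H.Adj y w → H.Adj x w := fun w hw hx hwx hyw => by
    by_contra hxw
    exact hcon ⟨hx, w, hw, hwx, hyw, hxw⟩
  have hdel : ∀ u v, (H.deleteEdges {s(y, x)}).Adj u v ↔ H.Adj u v ∧ ¬ (u = y ∧ v = x) ∧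
      ¬ (u = x ∧ v = y) := fun u v => by
    simp [deleteEdges_adj]
  have hle' := hmin (y := H.deleteEdges {s(y, x)}) ?_ (deleteEdges_le _)
  · exact ((hdel _ _).1 (hle' hyx)).2.1 ⟨rfl, rfl⟩
  intro u hu v hv huv
  have huy : u ≠ y := fun h => hy (h ▸ hu)
  have hvy : v ≠ y := fun h => hy (h ▸ hv)
  simp only [hdel]
  rcases hH u hu v hv huv with h | ⟨w, huw, hwv⟩
  · exact Or.inl ⟨h, fun h' => huy h'.1, fun h' => hvy h'.2⟩
  by_cases hwy : w = y
  · subst hwy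
    by_cases hux : u = x
    · subst hux
      exact Or.inl ⟨hx v hv hu huv.ne' hwv, fun h' => huy h'.1, fun h' => hvy h'.2⟩
    by_cases hvx : v = x
    · subst hvx
      exact Or.inl ⟨(hx u hu hv huv.ne huw.symm).symm, fun h' => huy h'.1, fun h' => hvy h'.2⟩
    · exact Or.inr ⟨w, ⟨huw, fun h' => huy h'.1, fun h' => hux h'.1⟩, hwv, fun h' => hvx h'.2,
        fun h' => hvy h'.2⟩
  · exact Or.inr ⟨w, ⟨huw, fun h' => huy h'.1, fun h' => hwy h'.2⟩, hwv, fun h' => hwy h'.1,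
      fun h' => hvy h'.2⟩

/-- Each neighbour `w` of `v` contributes as many neighbours in the square as `w` has neighbours in
`S`: besides itself, all of the latter except `v`. -/
theorem card_square_neighbors_le [Fintype V] [DecidableEq V] [DecidableRel H.Adj]
    [DecidableRel G.square.Adj] {S : Finset V} {v : V} (hv : v ∈ S)
    (hH : ∀ w ∈ S, G.square.Adj v w → H.Adj v w ∨ ∃ x, H.Adj v x ∧ H.Adj x w) :
    (S.filter (G.square.Adj v)).card ≤ ∑ w ∈ H.neighborFinset v, (S.filter (H.Adj w)).card := by
  calc (S.filter (G.square.Adj v)).card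
      ≤ ((H.neighborFinset v).biUnion fun w => insert w ((S.filter (H.Adj w)).erase v)).card := by
        refine Finset.card_le_card fun x hx => ?_
        obtain ⟨hxS, hvx⟩ := Finset.mem_filter.1 hx
        rw [Finset.mem_biUnion]
        rcases hH x hxS hvx with h | ⟨w, h1, h2⟩
        · exact ⟨x, (H.mem_neighborFinset _ _).2 h, Finset.mem_insert_self _ _⟩
        · exact ⟨w, (H.mem_neighborFinset _ _).2 h1, Finset.mem_insert_of_mem
            (Finset.mem_erase.2 ⟨hvx.ne', Finset.mem_filter.2 ⟨hxS, h2⟩⟩)⟩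
    _ ≤ ∑ w ∈ H.neighborFinset v, (insert w ((S.filter (H.Adj w)).erase v)).card :=
        Finset.card_biUnion_le
    _ ≤ ∑ w ∈ H.neighborFinset v, (S.filter (H.Adj w)).card := by
        refine Finset.sum_le_sum fun w hw => ?_
        have hmem : v ∈ S.filter (H.Adj w) :=
          Finset.mem_filter.2 ⟨hv, ((H.mem_neighborFinset _ _).1 hw).symm⟩
        have h1 := Finset.card_insert_le w ((S.filter (H.Adj w)).erase v)
        rw [Finset.card_erase_of_mem hmem] at h1
        have h2 := Finset.card_pos.2 ⟨v, hmem⟩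
        omega

/-! ### A vertex of small degree in the square -/

/-- The heart of the argument: induced subgraphs of the square have vertices of small degree. -/
theorem IsPlanar.exists_card_square_neighbors_le [Fintype V] [DecidableEq V] [DecidableRel G.Adj]
    [DecidableRel G.square.Adj] (hG : G.IsPlanar) (h4 : G.HasNoCycleOfLength 4) {S : Finset V}
    (hne : S.Nonempty) : ∃ v ∈ S, (S.filter (G.square.Adj v)).card ≤ G.maxDegree + 72 := by
  classical
  by_contra! hcon
  obtain ⟨H, hle, hH, hT⟩ := G.exists_reduced_subgraph (S : Set V)
  set D : V → ℕ := fun w => (S.filter (H.Adj w)).card with hD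
  have hDdeg : ∀ w, D w ≤ H.degree w := fun w => Finset.card_le_card fun x hx =>
    (H.mem_neighborFinset _ _).2 (Finset.mem_filter.1 hx).2
  have hDmax : ∀ w, D w ≤ G.maxDegree := fun w => by
    refine le_trans (Finset.card_le_card fun x hx => ?_) (G.degree_le_maxDegree w)
    exact (G.mem_neighborFinset _ _).2 (hle (Finset.mem_filter.1 hx).2)
  set B : Finset V := Finset.univ.filter fun w => 19 ≤ D w with hB
  have hmemB : ∀ w, w ∈ B ↔ 19 ≤ D w := fun w => by simp [hB]
  have hsum : ∀ v ∈ S, G.maxDegree + 72 < ∑ w ∈ H.neighborFinset v, D w := fun v hv =>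
    (hcon v hv).trans_le (card_square_neighbors_le hv fun w hw => hH v hv w hw)
  -- with at most one neighbour in `B`, the sum is at most `Δ + 4 * 18`
  have hS : ∀ v ∈ S, 6 ≤ H.degree v ∨ 2 ≤ (B.filter (H.Adj v)).card := by
    intro v hv
    by_contra! h
    obtain ⟨hdeg, hbig⟩ := h
    have hpos : (H.neighborFinset v).Nonempty := by
      rw [Finset.nonempty_iff_ne_empty]
      intro h0
      have := hsum v hv
      rw [h0, Finset.sum_empty] at this
      omega
    obtain ⟨w₀, hw₀, hrest⟩ : ∃ w₀ ∈ H.neighborFinset v, ∀ w ∈ (H.neighborFinset v).erase w₀,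
        D w ≤ 18 := by
      rcases (B.filter (H.Adj v)).eq_empty_or_nonempty with h0 | ⟨b, hb⟩
      · obtain ⟨w₀, hw₀⟩ := hpos
        refine ⟨w₀, hw₀, fun w hw => ?_⟩
        by_contra hD18
        have : w ∈ B.filter (H.Adj v) := Finset.mem_filter.2 ⟨(hmemB w).2 (by omega),
          (H.mem_neighborFinset _ _).1 (Finset.mem_of_mem_erase hw)⟩
        rw [h0] at this
        exact Finset.notMem_empty _ this
      · refine ⟨b, (H.mem_neighborFinset _ _).2 (Finset.mem_filter.1 hb).2, fun w hw => ?_⟩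
        by_contra hD18
        have : w ∈ B.filter (H.Adj v) := Finset.mem_filter.2 ⟨(hmemB w).2 (by omega),
          (H.mem_neighborFinset _ _).1 (Finset.mem_of_mem_erase hw)⟩
        exact Finset.ne_of_mem_erase hw (Finset.card_le_one.1 (by omega) _ this _ hb)
    have h1 : ∑ w ∈ (H.neighborFinset v).erase w₀, D w ≤ _ :=
      Finset.sum_le_card_nsmul _ _ _ hrest
    rw [Finset.card_erase_of_mem hw₀, card_neighborFinset_eq_degree, smul_eq_mul] at h1
    have h2 := Finset.add_sum_erase _ D hw₀
    have h3 := hsum v hv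
    have h4 := hDmax w₀
    have h5 : (H.degree v - 1) * 18 ≤ 4 * 18 := Nat.mul_le_mul_right _ (by omega)
    omega
  set A : Finset V := S.filter fun v => v ∉ B ∧ 2 ≤ (B.filter (H.Adj v)).card with hA
  have hAB : A.card ≤ 3 * B.card := by
    refine hG.card_le_three_mul_card h4 B A (Finset.disjoint_left.2 fun v hv =>
      (Finset.mem_filter.1 hv).2.1) fun a ha => (Finset.mem_filter.1 ha).2.2.trans
        (Finset.card_le_card fun b hb => ?_)
    rw [Finset.mem_filter] at hb ⊢
    exact ⟨hb.1, hle hb.2⟩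
  have hdeg2 : ∀ v, 2 ≤ (B.filter (H.Adj v)).card → 2 ≤ H.degree v := fun v h =>
    h.trans (Finset.card_le_card fun b hb =>
      (H.mem_neighborFinset _ _).2 (Finset.mem_filter.1 hb).2)
  have hcharge := hG.sum_charge_pos h4 hle S hne
    (fun v hv => (hS v hv).elim (fun h => by omega) (hdeg2 v)) hT
  have hle : ∀ v, (if v ∈ S then 6 - (H.degree v : ℚ)
      else if 3 ≤ H.degree v then 6 - 2 * (H.degree v : ℚ) else 0) ≤
      (if v ∈ A then 4 else 0) + if v ∈ B then -13 else 0 := by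
    intro v
    by_cases hvB : v ∈ B
    · have h19 : (19 : ℚ) ≤ H.degree v := by exact_mod_cast ((hmemB v).1 hvB).trans (hDdeg v)
      have h3 : 3 ≤ H.degree v := by
        have := ((hmemB v).1 hvB).trans (hDdeg v)
        omega
      have hvA : v ∉ A := fun h => (Finset.mem_filter.1 h).2.1 hvB
      rw [if_neg hvA, if_pos hvB, if_pos h3]
      split_ifs <;> linarith
    by_cases hvS : v ∈ S
    · rw [if_pos hvS, if_neg hvB]
      by_cases hvA : v ∈ A
      · have : (2 : ℚ) ≤ H.degree v := by
          exact_mod_cast hdeg2 v (Finset.mem_filter.1 hvA).2.2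
        rw [if_pos hvA]
        linarith
      · have : (6 : ℚ) ≤ H.degree v := by
          exact_mod_cast (hS v hvS).resolve_right fun h =>
            hvA (Finset.mem_filter.2 ⟨hvS, hvB, h⟩)
        rw [if_neg hvA]
        linarith
    · have hvA : v ∉ A := fun h => hvS (Finset.mem_filter.1 h).1
      rw [if_neg hvS, if_neg hvB, if_neg hvA]
      split_ifs with h
      · have : (3 : ℚ) ≤ H.degree v := by exact_mod_cast h
        linarith
      · norm_num
  replace hcharge := hcharge.trans_le (Finset.sum_le_sum fun v _ => hle v)
  rw [Finset.sum_add_distrib, Finset.sum_ite_mem, Finset.sum_ite_mem, Finset.univ_inter,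
    Finset.univ_inter, Finset.sum_const, Finset.sum_const, nsmul_eq_mul, nsmul_eq_mul] at hcharge
  have : (A.card : ℚ) ≤ 3 * B.card := by exact_mod_cast hAB
  linarith [(Nat.cast_nonneg B.card : (0 : ℚ) ≤ B.card)]

/-! ### Degeneracy and vertex orders -/

/-- The vertices of `S` are listed from the last to the first, each one having few neighbours among
those that remain. -/
theorem exists_order_of_degenerate [DecidableEq V] (Q : SimpleGraph V) [DecidableRel Q.Adj] (k : ℕ)
    (h : ∀ S : Finset V, S.Nonempty → ∃ v ∈ S, (S.filter (Q.Adj v)).card ≤ k) (n : ℕ) :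
    ∀ S : Finset V, S.card = n → ∃ f : V → ℕ, (∀ v ∈ S, f v < n) ∧ Set.InjOn f S ∧
      ∀ v ∈ S, (S.filter fun w => f w < f v ∧ Q.Adj v w).card ≤ k := by
  induction n with
  | zero =>
    intro S hS
    rw [Finset.card_eq_zero] at hS
    subst hS
    exact ⟨fun _ => 0, by simp⟩
  | succ n ih =>
    intro S hS
    obtain ⟨v, hv, hvk⟩ := h S (Finset.card_pos.1 (by omega))
    obtain ⟨f, h1, h2, h3⟩ := ih (S.erase v) (by rw [Finset.card_erase_of_mem hv]; omega)
    have hlt : ∀ w ∈ S, w ≠ v → f w < n := fun w hw hwv => h1 w (Finset.mem_erase.2 ⟨hwv, hw⟩)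
    refine ⟨Function.update f v n, fun w hw => ?_, fun w hw x hx hwx => ?_, fun w hw => ?_⟩
    · rcases eq_or_ne w v with rfl | hwv
      · simp
      · rw [Function.update_of_ne hwv]
        exact (hlt w hw hwv).trans (Nat.lt_succ_self n)
    · rcases eq_or_ne x v with hxv | hxv <;> rcases eq_or_ne w v with rfl | hwv
      · exact hxv.symm
      · subst hxv
        rw [Function.update_self, Function.update_of_ne hwv] at hwx
        exact absurd hwx (hlt w hw hwv).ne
      · rw [Function.update_self, Function.update_of_ne hxv] at hwx
        exact absurd hwx (hlt x hx hxv).ne'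
      · rw [Function.update_of_ne hwv, Function.update_of_ne hxv] at hwx
        exact h2 (Finset.mem_coe.2 (Finset.mem_erase.2 ⟨hwv, hw⟩))
          (Finset.mem_coe.2 (Finset.mem_erase.2 ⟨hxv, hx⟩)) hwx
    · rcases eq_or_ne w v with rfl | hwv
      · refine le_trans (Finset.card_le_card fun x hx => ?_) hvk
        rw [Finset.mem_filter] at hx ⊢
        exact ⟨hx.1, hx.2.2⟩
      · refine le_trans (Finset.card_le_card fun x hx => ?_)
          (h3 w (Finset.mem_erase.2 ⟨hwv, hw⟩))
        rw [Finset.mem_filter, Function.update_of_ne hwv] at hx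
        have hxv : x ≠ v := by
          rintro rfl
          rw [Function.update_self] at hx
          exact absurd (hlt w hw hwv) (not_lt.2 hx.2.1.le)
        rw [Function.update_of_ne hxv] at hx
        exact Finset.mem_filter.2 ⟨Finset.mem_erase.2 ⟨hxv, hx.1⟩, hx.2⟩

end SimpleGraph

theorem mainTheorem2 {V : Type*} [Fintype V] (G : SimpleGraph V) [DecidableRel G.Adj]
    (hplanar : G.IsPlanar) (h4 : G.HasNoCycleOfLength 4) :
    (∃ σ : V ≃ Fin (Fintype.card V), ∀ v : V,
      {w : V | σ w < σ v ∧ G.square.Adj v w}.ncard ≤ G.maxDegree + 72) ∧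
    G.square.IsDegenerate (G.maxDegree + 72) := by
  classical
  have key := fun (S : Finset V) (hS : S.Nonempty) =>
    hplanar.exists_card_square_neighbors_le h4 hS
  constructor
  · obtain ⟨f, h1, h2, h3⟩ := SimpleGraph.exists_order_of_degenerate G.square _ key _ Finset.univ rfl
    let g : V → Fin (Fintype.card V) := fun v => ⟨f v, h1 v (Finset.mem_univ v)⟩
    have hg : Function.Bijective g := by
      rw [Fintype.bijective_iff_injective_and_card, Fintype.card_fin]
      exact ⟨fun v w h => h2 (Finset.mem_coe.2 (Finset.mem_univ v))
        (Finset.mem_coe.2 (Finset.mem_univ w)) (congrArg Fin.val h), rfl⟩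
    refine ⟨Equiv.ofBijective g hg, fun v => ?_⟩
    rw [Set.ncard_eq_toFinset_card']
    refine le_trans (Finset.card_le_card fun w hw => ?_) (h3 v (Finset.mem_univ v))
    rw [Set.mem_toFinset] at hw
    exact Finset.mem_filter.2 ⟨Finset.mem_univ w, hw⟩
  · intro K hK
    obtain ⟨v, hv, hvk⟩ := key K.verts.toFinset (Set.toFinset_nonempty.2 hK)
    refine ⟨v, Set.mem_toFinset.1 hv, le_trans ?_ hvk⟩
    rw [Set.ncard_eq_toFinset_card']
    refine Finset.card_le_card fun w hw => ?_
    rw [Set.mem_toFinset] at hw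
    exact Finset.mem_filter.2 ⟨Set.mem_toFinset.2 (K.edge_vert hw.symm), K.adj_sub hw⟩
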